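/- **Setting.** A server with $N$ files is connected by an error-free broadcast link to $K=K_1+K_2<N$ users: $K_1$ fixed users with caches of $M_1$ files each and $K_2$ mobile users with caches of $M_2$ files each. Assume that $t_i=K_iM_i/N$ is an integer with $1\le t_i<K_i$ for $i=1,2$. A caching scheme divides every file into $F\ge 1$ packets of equal size; in the placement phase each user stores at most (cache size)$\,\cdot F$ packets, which may be arbitrary functions of all the files; for each demand vector $\mathbf d\in[N]^K$ the server broadcasts $S_{\mathbf d}$ packets, from which, together with its cache, every user recovers its requested file without error. The rate of a scheme is $\sup_{\mathbf d}S_{\mathbf d}/F$, and $R^*$ is the infimum of the rates of all schemes. **The proposed scheme.** Let $\mathcal K_1,\mathcal K_2$ be the (ordered) sets of fixed and mobile users. Each file is split into sub-packets $W^{(l_2,l_1)}_{n,\mathcal A,\mathcal B}$ of $b\ge1$ bits, where $\mathcal A\subset\mathcal K_1$, $|\mathcal A|=t_1$, $\mathcal B\subset\mathcal K_2$, $|\mathcal B|=t_2$, $0\le l_i<t_i$. A fixed user $k$ stores those with $k\in\mathcal A$, a mobile user $k$ those with $k\in\mathcal B$. For $\mathcal S_1=\{k_{1,0}<\dots<k_{1,t_1}\}\subset\mathcal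 K_1$, $\mathcal S_2=\{k_{2,0}<\dots<k_{2,t_2}\}\subset\mathcal K_2$ and $0\le m_i\le t_i$ put $$X^{(l_2,m_1)}_{\mathcal S_1,\mathcal B}=\bigoplus_{i<m_1}W^{(l_2,m_1-1)}_{d_{k_{1,i}},\mathcal S_1\setminus\{k_{1,i}\},\mathcal B}\oplus\bigoplus_{i>m_1}W^{(l_2,m_1)}_{d_{k_{1,i}},\mathcal S_1\setminus\{k_{1,i}\},\mathcal B},\qquad Y^{(m_2,l_1)}_{\mathcal A,\mathcal S_2}=\bigoplus_{i<m_2}W^{(m_2-1,l_1)}_{d_{k_{2,i}},\mathcal A,\mathcal S_2\setminus\{k_{2,i}\}}\oplus\bigoplus_{i>m_2}W^{(m_2,l_1)}_{d_{k_{2,i}},\mathcal A,\mathcal S_2\setminus\{k_{2,i}\}}.$$ Join $X^{(l_2,m_1)}_{\mathcal S_1,\mathcal B}$ and $Y^{(m_2,l_1)}_{\mathcal A,\mathcal S_2}$ by an edge if $\mathcal S_1\setminus\{k_{1,m_1}\}=\mathcal A$ and $\mathcal S_2\setminus\{k_{2,m_2}\}=\mathcal B$. If $M_1\ge M_2$,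 let $c=\lceil t_2(K_1-t_1)/(K_2-t_2)\rceil$ and take a matching that saturates all vertices $X$ and uses only vertices $Y$ with $l_1<c$. The server sends $X\oplus Y$ for every edge of the matching, each unmatched $Y$ with $l_1<c$, and, for every $\mathcal A,\mathcal S_2$ and $l_1\ge c$, the $t_2$ sums $Y^{(j,l_1)}_{\mathcal A,\mathcal S_2}\oplus Y^{(j+1,l_1)}_{\mathcal A,\mathcal S_2}$, $0\le j<t_2$. If $M_1<M_2$, the roles of $X$ and $Y$ (and of the two groups of users) are exchanged. **Statement.** Such matchings exist, and for every $b$ and every choice of the matchings (one for each $\mathbf d$) the proposed scheme is a caching scheme for the system. Let $R$ be its rate, and let $$R_D=\sum_{i=0}^{K-1}\prod_{j=0}^{i}\Bigl(1-\frac{M_{(j)}}{N}\Bigr),\qquad M_{(0)}\le M_{(1)}\le\dots\le M_{(K-1)}\ \text{the cache sizes of the }K\text{ users in increasing order},$$ be the rate of the known heterogeneous-cache scheme. Then $R^*>0$, $R<2R_D$, and $$\frac{R}{R^*}<\frac{2R_D}{R^*}<12 .$$ In particular $R/R^*<12$, that is, the proposed scheme is order-optimal. -/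

import Mathlib

/-! ### Coded caching systems over an error-free shared link -/

/-- A caching scheme for the users `U` and `N` files. Every file consists of packets of equal size,
indexed by `Packet`; each packet is an element of the finite alphabet `Symbol`, so the file size is
`F = Nat.card Packet`. User `u` has `Nat.card (CacheSlot u)` cached packets, which may be arbitrary
functions of the whole library; for the demand vector `d` the server sends `Nat.card (Signal d)`
packets. All sizes are measured in packets. -/
structure CachingScheme (U : Type) (N : ℕ) where
  Symbol : Type
  Packet : Type
  CacheSlot : U → Type
  Signal : (U → Fin N) → Type
  finite_symbol : Finite Symbol
  nontrivial_symbol : Nontrivial Symbol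
  finite_packet : Finite Packet
  nonempty_packet : Nonempty Packet
  finite_cacheSlot : ∀ u, Finite (CacheSlot u)
  finite_signal : ∀ d, Finite (Signal d)
  /-- Placement phase: the cache content of user `u`. -/
  place : ∀ u, (Fin N → Packet → Symbol) → CacheSlot u → Symbol
  /-- Delivery phase: what the server transmits for the demand vector `d`. -/
  send : ∀ d, (Fin N → Packet → Symbol) → Signal d → Symbol

namespace CachingScheme

/-- The scheme respects the cache sizes `M u` (measured in files), and for every demand vector
every user recovers the requested file from its cache and the transmission, without error. -/
def IsValid {U : Type} {N : ℕ} (S : CachingScheme U N) (M : U → ℝ) : Prop :=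
  (∀ u, (Nat.card (S.CacheSlot u) : ℝ) ≤ M u * Nat.card S.Packet) ∧
  ∀ (d : U → Fin N) (u : U),
    ∃ dec : (S.CacheSlot u → S.Symbol) → (S.Signal d → S.Symbol) → (S.Packet → S.Symbol),
      ∀ W : Fin N → S.Packet → S.Symbol, dec (S.place u W) (S.send d W) = W (d u)

/-- The worst-case transmission rate `sup_d S_d / F`, in files. -/
noncomputable def rate {U : Type} {N : ℕ} (S : CachingScheme U N) : ℝ :=
  ⨆ d : U → Fin N, (Nat.card (S.Signal d) : ℝ) / Nat.card S.Packet

end CachingScheme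

/-- The optimal rate `R*` of the system with users `U`, cache sizes `M` and `N` files: the infimum
of the rates of all valid schemes. -/
noncomputable def optimalRate {U : Type} (M : U → ℝ) (N : ℕ) : ℝ :=
  sInf {R : ℝ | ∃ S : CachingScheme U N, S.IsValid M ∧ S.rate = R}

/-- The rate `R_D = ∑_{i < K} ∏_{j ≤ i} (1 - M_j / N)` of the heterogeneous-cache scheme, where
`M_0 ≤ M_1 ≤ ⋯ ≤ M_{K-1}` are the cache sizes of the users in increasing order. -/
noncomputable def heterogeneousRate {U : Type} [Fintype U] (M : U → ℝ) (N : ℕ) : ℝ :=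
  let L : List ℝ := (Finset.univ.val.map M : Multiset ℝ).sort (· ≤ ·)
  ∑ i ∈ Finset.range L.length, ((L.take (i + 1)).map fun m : ℝ => 1 - m / (N : ℝ)).prod

/-! ### The concatenating placement and saturating matching delivery scheme -/

namespace CSM

/-- The `t`-element subsets of `{0, …, K - 1}`. -/
abbrev KSubset (K t : ℕ) : Type := {A : Finset (Fin K) // A.card = t}

/-- The element `k_m` of `S = {k_0 < k_1 < ⋯ < k_t}`. -/
def nth {K t : ℕ} (S : KSubset K (t + 1)) (m : Fin (t + 1)) : Fin K :=
  S.1.orderEmbOfFin S.2 m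

/-- The set `S \ {k_m}`. -/
def remove {K t : ℕ} (S : KSubset K (t + 1)) (m : Fin (t + 1)) : KSubset K t :=
  ⟨S.1.erase (nth S m), by
    have h : nth S m ∈ S.1 := Finset.orderEmbOfFin_mem S.1 S.2 m
    rw [Finset.card_erase_of_mem h, S.2]; rfl⟩

/-- The users: `K₁` fixed users and `K₂` mobile users. -/
abbrev User (K₁ K₂ : ℕ) : Type := Fin K₁ ⊕ Fin K₂

/-- The cache sizes: `M₁` for each fixed user, `M₂` for each mobile user. -/
def cacheSize (K₁ K₂ : ℕ) (M₁ M₂ : ℝ) : User K₁ K₂ → ℝ :=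
  Sum.elim (fun _ => M₁) (fun _ => M₂)

/-- The index `(A, B, l₂, l₁)` of a sub-packet of a file: the file is split into packets indexed
by `A`, and each of these into sub-packets indexed by `(B, l₂, l₁)`. -/
structure SubPacket (K₁ K₂ t₁ t₂ : ℕ) where
  A : KSubset K₁ t₁
  B : KSubset K₂ t₂
  l₂ : Fin t₂
  l₁ : Fin t₁

/-- Placement: a fixed user `k` stores the sub-packets (of all files) with `k ∈ A`, a mobile user
`k` those with `k ∈ B`. -/
def Stores {K₁ K₂ t₁ t₂ : ℕ} (u : User K₁ K₂) (p : SubPacket K₁ K₂ t₁ t₂) : Prop :=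
  Sum.elim (fun k => k ∈ p.A.1) (fun k => k ∈ p.B.1) u

/-- The index of the vertex `X^{(l₂, m₁)}_{S₁, B}`. -/
structure XVertex (K₁ K₂ t₁ t₂ : ℕ) where
  S₁ : KSubset K₁ (t₁ + 1)
  B : KSubset K₂ t₂
  l₂ : Fin t₂
  m₁ : Fin (t₁ + 1)

/-- The index of the vertex `Y^{(m₂, l₁)}_{A, S₂}`. -/
structure YVertex (K₁ K₂ t₁ t₂ : ℕ) where
  A : KSubset K₁ t₁
  S₂ : KSubset K₂ (t₂ + 1)
  m₂ : Fin (t₂ + 1)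
  l₁ : Fin t₁

/-- The coded packet `X^{(l₂, m₁)}_{S₁, B}` for the demand vector `d`; the operation `⊕` is the
addition of `V`. -/
def xValue {K₁ K₂ t₁ t₂ N : ℕ} {V : Type} [AddCommGroup V] (d : User K₁ K₂ → Fin N)
    (W : Fin N → SubPacket K₁ K₂ t₁ t₂ → V) (x : XVertex K₁ K₂ t₁ t₂) : V :=
  (∑ i : {i : Fin (t₁ + 1) // i < x.m₁},
    W (d (Sum.inl (nth x.S₁ i.1))) ⟨remove x.S₁ i.1, x.B, x.l₂,
      ⟨x.m₁.1 - 1, by have := i.2; have := x.m₁.2; omega⟩⟩) +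
  ∑ i : {i : Fin (t₁ + 1) // x.m₁ < i},
    W (d (Sum.inl (nth x.S₁ i.1))) ⟨remove x.S₁ i.1, x.B, x.l₂,
      ⟨x.m₁.1, by have := i.2; have := i.1.2; omega⟩⟩

/-- The coded packet `Y^{(m₂, l₁)}_{A, S₂}` for the demand vector `d`. -/
def yValue {K₁ K₂ t₁ t₂ N : ℕ} {V : Type} [AddCommGroup V] (d : User K₁ K₂ → Fin N)
    (W : Fin N → SubPacket K₁ K₂ t₁ t₂ → V) (y : YVertex K₁ K₂ t₁ t₂) : V :=
  (∑ i : {i : Fin (t₂ + 1) // i < y.m₂},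
    W (d (Sum.inr (nth y.S₂ i.1))) ⟨y.A, remove y.S₂ i.1,
      ⟨y.m₂.1 - 1, by have := i.2; have := y.m₂.2; omega⟩, y.l₁⟩) +
  ∑ i : {i : Fin (t₂ + 1) // y.m₂ < i},
    W (d (Sum.inr (nth y.S₂ i.1))) ⟨y.A, remove y.S₂ i.1,
      ⟨y.m₂.1, by have := i.2; have := i.1.2; omega⟩, y.l₁⟩

/-- The bipartite graph: `X^{(l₂, m₁)}_{S₁, B}` and `Y^{(m₂, l₁)}_{A, S₂}` are adjacent if and only
if `S₁ \ {k_{1, m₁}} = A` and `S₂ \ {k_{2, m₂}} = B`. -/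
def Adjacent {K₁ K₂ t₁ t₂ : ℕ} (x : XVertex K₁ K₂ t₁ t₂) (y : YVertex K₁ K₂ t₁ t₂) : Prop :=
  remove x.S₁ x.m₁ = y.A ∧ remove y.S₂ y.m₂ = x.B

open Classical in
/-- The `Y`-vertices of the induced subgraph used for the matching are those with
`l₁ < yBound`; these are all `Y`-vertices if `M₁ < M₂`. -/
noncomputable def yBound (K₁ K₂ t₁ t₂ : ℕ) (M₁ M₂ : ℝ) : ℕ :=
  if M₁ ≥ M₂ then ⌈(t₂ * (K₁ - t₁) : ℝ) / (K₂ - t₂)⌉₊ else t₁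

open Classical in
/-- The `X`-vertices of the induced subgraph used for the matching are those with
`l₂ < xBound`; these are all `X`-vertices if `M₁ ≥ M₂`. -/
noncomputable def xBound (K₁ K₂ t₁ t₂ : ℕ) (M₁ M₂ : ℝ) : ℕ :=
  if M₁ ≥ M₂ then t₂ else ⌈(t₁ * (K₂ - t₂) : ℝ) / (K₁ - t₁)⌉₊

/-- A matching in the induced subgraph which saturates all `X`-vertices if `M₁ ≥ M₂`, and all
`Y`-vertices if `M₁ < M₂`. -/
structure SaturatingMatching (K₁ K₂ t₁ t₂ : ℕ) (M₁ M₂ : ℝ) where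
  edges : Set (XVertex K₁ K₂ t₁ t₂ × YVertex K₁ K₂ t₁ t₂)
  adjacent : ∀ e ∈ edges, Adjacent e.1 e.2
  x_lt : ∀ e ∈ edges, e.1.l₂.1 < xBound K₁ K₂ t₁ t₂ M₁ M₂
  y_lt : ∀ e ∈ edges, e.2.l₁.1 < yBound K₁ K₂ t₁ t₂ M₁ M₂
  x_inj : ∀ e ∈ edges, ∀ e' ∈ edges, e.1 = e'.1 → e = e'
  y_inj : ∀ e ∈ edges, ∀ e' ∈ edges, e.2 = e'.2 → e = e'
  saturates_x : M₁ ≥ M₂ → ∀ x, ∃ e ∈ edges, e.1 = x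
  saturates_y : M₁ < M₂ → ∀ y, ∃ e ∈ edges, e.2 = y

/-- An `X`-vertex of the induced subgraph outside the matching. -/
abbrev XDirect {K₁ K₂ t₁ t₂ : ℕ} {M₁ M₂ : ℝ} (m : SaturatingMatching K₁ K₂ t₁ t₂ M₁ M₂) : Type :=
  {x : XVertex K₁ K₂ t₁ t₂ // x.l₂.1 < xBound K₁ K₂ t₁ t₂ M₁ M₂ ∧ ∀ e ∈ m.edges, e.1 ≠ x}

/-- A `Y`-vertex of the induced subgraph outside the matching. -/
abbrev YDirect {K₁ K₂ t₁ t₂ : ℕ} {M₁ M₂ : ℝ} (m : SaturatingMatching K₁ K₂ t₁ t₂ M₁ M₂) : Type :=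
  {y : YVertex K₁ K₂ t₁ t₂ // y.l₁.1 < yBound K₁ K₂ t₁ t₂ M₁ M₂ ∧ ∀ e ∈ m.edges, e.2 ≠ y}

/-- The indices `(S₁, B, l₂, j)` of the `t₁` combinations sent for each group of `t₁ + 1` vertices
`X^{(l₂, 0)}_{S₁, B}, …, X^{(l₂, t₁)}_{S₁, B}` outside the induced subgraph. -/
abbrev XCoded (K₁ K₂ t₁ t₂ : ℕ) (M₁ M₂ : ℝ) : Type :=
  KSubset K₁ (t₁ + 1) × KSubset K₂ t₂ ×
    {l₂ : Fin t₂ // xBound K₁ K₂ t₁ t₂ M₁ M₂ ≤ l₂.1} × Fin t₁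

/-- The indices `(A, S₂, l₁, j)` of the `t₂` combinations sent for each group of `t₂ + 1` vertices
`Y^{(0, l₁)}_{A, S₂}, …, Y^{(t₂, l₁)}_{A, S₂}` outside the induced subgraph. -/
abbrev YCoded (K₁ K₂ t₁ t₂ : ℕ) (M₁ M₂ : ℝ) : Type :=
  KSubset K₁ t₁ × KSubset K₂ (t₂ + 1) ×
    {l₁ : Fin t₁ // yBound K₁ K₂ t₁ t₂ M₁ M₂ ≤ l₁.1} × Fin t₂

/-- The indices of all packets sent by the server. -/
abbrev Sent {K₁ K₂ t₁ t₂ : ℕ} {M₁ M₂ : ℝ} (m : SaturatingMatching K₁ K₂ t₁ t₂ M₁ M₂) : Type :=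
  m.edges ⊕ XDirect m ⊕ YDirect m ⊕ XCoded K₁ K₂ t₁ t₂ M₁ M₂ ⊕ YCoded K₁ K₂ t₁ t₂ M₁ M₂

/-- Delivery: the server sends `X ⊕ Y` for every edge `(X, Y)` of the matching, the remaining
vertices of the induced subgraph, and the sums of consecutive vertices
`X^{(l₂, j)}_{S₁, B} ⊕ X^{(l₂, j + 1)}_{S₁, B}`, respectively
`Y^{(j, l₁)}_{A, S₂} ⊕ Y^{(j + 1, l₁)}_{A, S₂}`, of the groups outside the induced subgraph. -/
def deliver {K₁ K₂ t₁ t₂ N : ℕ} {M₁ M₂ : ℝ} {V : Type} [AddCommGroup V]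
    (m : SaturatingMatching K₁ K₂ t₁ t₂ M₁ M₂) (d : User K₁ K₂ → Fin N)
    (W : Fin N → SubPacket K₁ K₂ t₁ t₂ → V) : Sent m → V
  | .inl e => xValue d W e.1.1 + yValue d W e.1.2
  | .inr (.inl x) => xValue d W x.1
  | .inr (.inr (.inl y)) => yValue d W y.1
  | .inr (.inr (.inr (.inl (S₁, B, l₂, j)))) =>
      xValue d W ⟨S₁, B, l₂.1, j.castSucc⟩ + xValue d W ⟨S₁, B, l₂.1, j.succ⟩
  | .inr (.inr (.inr (.inr (A, S₂, l₁, j)))) =>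
      yValue d W ⟨A, S₂, j.castSucc, l₁.1⟩ + yValue d W ⟨A, S₂, j.succ, l₁.1⟩

instance {K₁ K₂ t₁ t₂ : ℕ} : Finite (SubPacket K₁ K₂ t₁ t₂) :=
  Finite.of_injective (fun p => (p.A, p.B, p.l₂, p.l₁)) (by
    rintro ⟨⟩ ⟨⟩ h; simpa using h)

instance {K₁ K₂ t₁ t₂ : ℕ} : Finite (XVertex K₁ K₂ t₁ t₂) :=
  Finite.of_injective (fun x => (x.S₁, x.B, x.l₂, x.m₁)) (by
    rintro ⟨⟩ ⟨⟩ h; simpa using h)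

instance {K₁ K₂ t₁ t₂ : ℕ} : Finite (YVertex K₁ K₂ t₁ t₂) :=
  Finite.of_injective (fun y => (y.A, y.S₂, y.m₂, y.l₁)) (by
    rintro ⟨⟩ ⟨⟩ h; simpa using h)

theorem kSubset_nonempty {K t : ℕ} (h : t ≤ K) : Nonempty (KSubset K t) := by
  obtain ⟨A, -, hA⟩ := Finset.exists_subset_card_eq (s := (Finset.univ : Finset (Fin K)))
    (n := t) (by simpa using h)
  exact ⟨⟨A, hA⟩⟩

/-- The scheme for `K₁` fixed users, `K₂` mobile users and `N` files. Every sub-packet is a string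
of `b ≥ 1` bits and `⊕` is the bitwise exclusive or. The saturating matching may be chosen
separately for every demand vector. -/
def scheme {K₁ K₂ t₁ t₂ : ℕ} (N : ℕ) {M₁ M₂ : ℝ}
    (ht₁ : 1 ≤ t₁) (htK₁ : t₁ < K₁) (ht₂ : 1 ≤ t₂) (htK₂ : t₂ < K₂) (b : ℕ) (hb : 1 ≤ b)
    (m : (User K₁ K₂ → Fin N) → SaturatingMatching K₁ K₂ t₁ t₂ M₁ M₂) :
    CachingScheme (User K₁ K₂) N where
  Symbol := Fin b → ZMod 2
  Packet := SubPacket K₁ K₂ t₁ t₂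
  CacheSlot u := Fin N × {p : SubPacket K₁ K₂ t₁ t₂ // Stores u p}
  Signal d := Sent (m d)
  finite_symbol := inferInstance
  nontrivial_symbol := haveI : Nonempty (Fin b) := ⟨⟨0, hb⟩⟩; inferInstance
  finite_packet := inferInstance
  nonempty_packet :=
    (kSubset_nonempty htK₁.le).elim fun A => (kSubset_nonempty htK₂.le).elim fun B =>
      ⟨⟨A, B, ⟨0, ht₂⟩, ⟨0, ht₁⟩⟩⟩
  finite_cacheSlot _ := inferInstance
  finite_signal _ := inferInstance
  place _ W s := W s.1 s.2.1
  send d W := deliver (m d) d W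

end CSM

/-! Every comparison passes through one number, q = (K - t)/t, where K and t belong to the group
with the smaller caches (the mobile users if M₁ ≥ M₂). It is shown that R ≤ q, that R_D < q < 2 R_D,
and that q ≤ 6 R*. Hence R ≤ q < 2 R_D < 2q ≤ 12 R*, and R* > 0 because q > 0.

R ≤ q (`scheme_rate_le`): the packets sent inject into the vertices on the non-saturated side of the
graph, and the number of these vertices divided by the number of sub-packets of a file is exactly q.

R_D < q < 2 R_D (`heterogeneousRate_bounds`): with Q = 1 - t/K, q = Q/(1 - Q) is the infinite
geometric series that dominates R_D, and the first K terms of R_D already sum to q(1 - Q^K), where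
Q^K ≤ e^(-t) < 1/2.

q ≤ 6 R* (`le_six_mul_optimalRate`): the cut-set bound is applied to users of the smaller-cache
group only, with their number chosen so that together they cache about half of the library.

Matchings exist because adjacency means having the same base (A, B): the graph is a disjoint union
of complete bipartite graphs, and c is chosen so that each of them has enough vertices on the larger
side. Decoding works because a user has cached every summand it does not request itself, and also
the whole partner of every edge it needs. -/

/-- An injection over a common base exists as soon as the fibres allow it. -/
theorem exists_injective_of_card_fiber_le {α β ι : Type} [Finite α] [Finite β] (i : α → ι)
    (j : β → ι) (h : ∀ c, Nat.card {a // i a = c} ≤ Nat.card {b // j b = c}) :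
    ∃ f : α → β, Function.Injective f ∧ ∀ a, j (f a) = i a := by
  classical
  have he : ∀ c, Nonempty ({a // i a = c} ↪ {b // j b = c}) := fun c => by
    have := Fintype.ofFinite {a // i a = c}
    have := Fintype.ofFinite {b // j b = c}
    refine Function.Embedding.nonempty_of_card_le ?_
    simpa only [Nat.card_eq_fintype_card] using h c
  let e := fun c => (he c).some
  have hf : ∀ a, j (e (i a) ⟨a, rfl⟩).1 = i a := fun a => (e (i a) ⟨a, rfl⟩).2
  have key : ∀ a c (hc : i a = c), (e (i a) ⟨a, rfl⟩).1 = (e c ⟨a, hc⟩).1 := by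
    rintro a c rfl; rfl
  refine ⟨fun a => (e (i a) ⟨a, rfl⟩).1, fun a a' haa => ?_, hf⟩
  have hi : i a = i a' := by rw [← hf a, ← hf a']; exact congrArg j haa
  have haa' : (e (i a) ⟨a, rfl⟩).1 = (e (i a') ⟨a', rfl⟩).1 := haa
  rw [key a _ hi] at haa'
  have := (e (i a')).injective (Subtype.ext haa')
  exact congrArg Subtype.val this

/-- Reduces decodability to a separation property: a decoder exists once two libraries that give the
same cache and the same transmission also agree on the requested file. No decoding map has to be
constructed. -/
theorem exists_decoder {α β γ δ : Type} [Nonempty δ] (f : α → β) (g : α → γ) (h : α → δ)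
    (H : ∀ a a', f a = f a' → g a = g a' → h a = h a') :
    ∃ dec : β → γ → δ, ∀ a, dec (f a) (g a) = h a := by
  classical
  refine ⟨fun b c => if hx : ∃ a, f a = b ∧ g a = c then h hx.choose else Classical.arbitrary δ,
    fun a => ?_⟩
  have hx : ∃ a', f a' = f a ∧ g a' = g a := ⟨a, rfl, rfl⟩
  simp only [dif_pos hx]
  exact H _ _ hx.choose_spec.1 hx.choose_spec.2

/-! ### The cut-set bound -/

namespace CachingScheme

/-- Finiteness of `U` matters: the supremum is over finitely many demands, hence bounded and not a
default value. -/
theorem signal_le_rate {U : Type} [Finite U] {N : ℕ} (S : CachingScheme U N) (d : U → Fin N) :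
    (Nat.card (S.Signal d) : ℝ) ≤ S.rate * Nat.card S.Packet := by
  have := S.finite_packet
  have := S.nonempty_packet
  have hF : (0 : ℝ) < Nat.card S.Packet := by exact_mod_cast Nat.card_pos
  rw [← div_le_iff₀ hF]
  exact le_ciSup (f := fun d => (Nat.card (S.Signal d) : ℝ) / Nat.card S.Packet)
    (Set.finite_range _).bddAbove d

theorem cutSet_bound {U : Type} [Finite U] {N : ℕ} (S : CachingScheme U N) {M : U → ℝ}
    (hS : S.IsValid M) {s p : ℕ} (v : Fin s → U) (hv : Function.Injective v) (hN : 0 < N)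
    (hsp : N ≤ p * s) : (N : ℝ) ≤ ∑ i, M (v i) + p * S.rate := by
  classical
  have := S.finite_packet
  have := S.nonempty_packet
  have := S.finite_symbol
  have := S.nontrivial_symbol
  have := S.finite_cacheSlot
  have := S.finite_signal
  have : Nonempty (Fin N) := ⟨⟨0, hN⟩⟩
  have hF : (0 : ℝ) < Nat.card S.Packet := by exact_mod_cast Nat.card_pos
  obtain ⟨e⟩ : Nonempty (Fin N ↪ Fin p × Fin s) :=
    Function.Embedding.nonempty_of_card_le (by simpa using hsp)
  -- The p demand vectors are arranged so that user `v i` in round j asks for the file that `e`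
  -- places at (j, i). Thus the s users see all N files over p rounds. Unused positions and all
  -- other users get arbitrary files.
  let d : Fin p → U → Fin N := fun j =>
    Function.extend v (fun i => Function.invFun e (j, i)) (fun _ => ⟨0, hN⟩)
  have hd : ∀ n, d (e n).1 (v (e n).2) = n := fun n => by
    simp only [d, hv.extend_apply]
    exact Function.leftInverse_invFun e.injective n
  let Φ : (Fin N → S.Packet → S.Symbol) →
      (∀ i : Fin s, S.CacheSlot (v i) → S.Symbol) × (∀ j : Fin p, S.Signal (d j) → S.Symbol) :=
    fun W => (fun i => S.place (v i) W, fun j => S.send (d j) W)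
  have hΦ : Function.Injective Φ := by
    intro W W' h
    funext n
    obtain ⟨dec, hdec⟩ := hS.2 (d (e n).1) (v (e n).2)
    have h1 := hdec W
    have h2 := hdec W'
    have hp : S.place (v (e n).2) W = S.place (v (e n).2) W' := congrFun (congrArg Prod.fst h) _
    have hs : S.send (d (e n).1) W = S.send (d (e n).1) W' := congrFun (congrArg Prod.snd h) _
    rw [hd] at h1 h2
    rw [← h1, ← h2, hp, hs]
  -- Both sides are powers of the alphabet size, which is at least 2, so the exponents can be
  -- compared.
  have hc := Nat.card_le_card_of_injective Φ hΦ
  simp only [Nat.card_prod, Nat.card_pi, Nat.card_fun, Finset.prod_pow_eq_pow_sum, ← pow_add]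
    at hc
  have hc' := (Nat.pow_le_pow_iff_right Finite.one_lt_card).1 hc
  have h1 : (N : ℝ) * Nat.card S.Packet ≤ ∑ i, (Nat.card (S.CacheSlot (v i)) : ℝ) +
      ∑ j, (Nat.card (S.Signal (d j)) : ℝ) := by
    rw [Finset.sum_const, Finset.card_univ, Fintype.card_fin, smul_eq_mul] at hc'
    exact_mod_cast hc'
  have h2 : ∑ i, (Nat.card (S.CacheSlot (v i)) : ℝ) ≤ (∑ i, M (v i)) * Nat.card S.Packet := by
    rw [Finset.sum_mul]
    exact Finset.sum_le_sum fun i _ => hS.1 (v i)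
  have h3 : ∑ j, (Nat.card (S.Signal (d j)) : ℝ) ≤ p * S.rate * Nat.card S.Packet := by
    refine (Finset.sum_le_sum fun j _ => S.signal_le_rate (d j)).trans ?_
    simp [mul_assoc]
  refine le_of_mul_le_mul_right ?_ hF
  linarith [add_mul (∑ i, M (v i)) (p * S.rate) (Nat.card S.Packet : ℝ)]

end CachingScheme

/-- The cut-set bound for `1 / (2 μ)` users, rounded to an integer, which all have caches of size
`m = μ N`. -/
theorem le_six_mul_optimalRate {U : Type} [Finite U] {M : U → ℝ} {N K t : ℕ} {m : ℝ}
    (hne : ∃ S : CachingScheme U N, S.IsValid M) (v : Fin K → U) (hv : Function.Injective v)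
    (hm : ∀ i, M (v i) = m) (ht : 1 ≤ t) (htK : t < K) (hKN : K + 1 ≤ N)
    (h : (t : ℝ) = K * m / N) : ((K : ℝ) - t) / t ≤ 6 * optimalRate M N := by
  have hN : (0 : ℝ) < N := by exact_mod_cast (by omega : 0 < N)
  have hK : (0 : ℝ) < K := by exact_mod_cast (by omega : 0 < K)
  have ht1 : (1 : ℝ) ≤ t := by exact_mod_cast ht
  have ht0 : (0 : ℝ) < t := by linarith
  have htK' : (t : ℝ) < K := by exact_mod_cast htK
  have hKN' : (K : ℝ) + 1 ≤ N := by exact_mod_cast hKN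
  -- `s` is K/(2t) = N/(2m) rounded to the nearest integer. The bound below is essentially s(1 -
  -- st/K), whose maximum over real s is at K/(2t).
  set x : ℝ := K / (2 * t) + 1 / 2 with hx
  set s : ℕ := ⌊x⌋₊ with hs
  have hq : (K : ℝ) / (2 * t) ≤ K / 2 := by
    gcongr; linarith
  have hq2 : 1 / 2 ≤ (K : ℝ) / (2 * t) := by
    rw [le_div_iff₀ (by positivity)]; linarith
  have hx1 : 1 ≤ x := by linarith
  have hs1 : 1 ≤ s := Nat.le_floor (by simpa using hx1)
  have hsx : (s : ℝ) ≤ x := Nat.floor_le (by linarith)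
  have hxs : x < s + 1 := Nat.lt_floor_add_one x
  have hs0 : (0 : ℝ) < s := by exact_mod_cast hs1
  have hsN : (s : ℝ) ≤ N / 2 := by linarith
  have hsK : s ≤ K := by
    have : (s : ℝ) < K + 1 := by linarith
    have : s < K + 1 := by exact_mod_cast this
    omega
  set p : ℕ := ⌈(N : ℝ) / s⌉₊ with hp
  have hp1 : (N : ℝ) / s ≤ p := Nat.le_ceil _
  have hp2 : (p : ℝ) < N / s + 1 := Nat.ceil_lt_add_one (by positivity)
  have hp0 : (0 : ℝ) < p := lt_of_lt_of_le (by positivity) hp1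
  have hNp : N ≤ p * s := by
    have := (div_le_iff₀ hs0).1 hp1
    exact_mod_cast this
  -- Rounding N/s up costs at most s ≤ N/2, which gives the factor 3/2.
  have hps : (p : ℝ) * s ≤ 3 / 2 * N := by
    have : (p : ℝ) * s ≤ (N / s + 1) * s := by gcongr
    have h2 : ((N : ℝ) / s + 1) * s = N + s := by field_simp
    linarith
  -- `|s t - K / 2| ≤ t / 2`
  have e1 : (s : ℝ) * t ≤ K / 2 + t / 2 := by
    have : (s : ℝ) * t ≤ x * t := by gcongr
    have h2 : x * t = K / 2 + t / 2 := by rw [hx]; field_simp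
    linarith
  have e2 : (K : ℝ) / 2 - t / 2 ≤ s * t := by
    have : x * t ≤ (s + 1) * t := by gcongr
    have h2 : x * t = K / 2 + t / 2 := by rw [hx]; field_simp
    linarith
  -- 4st(K - st) = K² - 4(st - K/2)² ≥ K² - t² ≥ (K - t)K. The constant 6 is this 4 times the 3/2
  -- above.
  have e3 : ((K : ℝ) - t) * K ≤ 4 * (s * t) * (K - s * t) := by
    nlinarith
  have hm' : m = t * N / K := by rw [h]; field_simp
  have hL : (K - t) / t ≤ 6 * (((N : ℝ) - s * m) / p) := by
    rw [← mul_div_assoc, div_le_div_iff₀ ht0 hp0, hm']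
    have h3 : ((K : ℝ) - t) * (p * s) ≤ (K - t) * (3 / 2 * N) :=
      mul_le_mul_of_nonneg_left hps (by linarith)
    have h4 : ((K : ℝ) - t) * (3 / 2 * N) * K ≤ 6 * N * ((s * t) * (K - s * t)) := by
      nlinarith
    have h5 : 6 * ((N : ℝ) - s * (t * N / K)) * t * (s * K) = 6 * N * ((s * t) * (K - s * t)) := by
      field_simp
    refine le_of_mul_le_mul_right (?_ : _ * (s * (K : ℝ)) ≤ _ * (s * (K : ℝ))) (by positivity)
    rw [h5]
    nlinarith
  refine hL.trans (mul_le_mul_of_nonneg_left ?_ (by norm_num))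
  obtain ⟨S₀, hS₀⟩ := hne
  -- The infimum needs a nonempty set, since `sInf ∅ = 0` in the reals.
  refine le_csInf ⟨_, S₀, hS₀, rfl⟩ ?_
  rintro R ⟨S, hS, rfl⟩
  have := S.cutSet_bound hS (v ∘ Fin.castLE hsK) (hv.comp (Fin.castLE_injective hsK))
    (by omega) hNp
  simp only [Function.comp, hm, Finset.sum_const, Finset.card_univ, Fintype.card_fin,
    nsmul_eq_mul] at this
  rw [div_le_iff₀ hp0]
  linarith

/-! ### The rate of the heterogeneous-cache scheme -/

/-- `∑ i, ∏ j ≤ i, q j` for a list `q`. -/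
noncomputable def prefixProdSum (L : List ℝ) : ℝ :=
  ∑ i ∈ Finset.range L.length, (L.take (i + 1)).prod

/-- Horner form. It turns both geometric estimates below into inductions on the map x ↦ Q(1 + x),
whose fixed point is Q/(1 - Q). -/
theorem prefixProdSum_cons (a : ℝ) (L : List ℝ) :
    prefixProdSum (a :: L) = a * (1 + prefixProdSum L) := by
  simp [prefixProdSum, Finset.sum_range_succ', mul_add, Finset.mul_sum, add_comm]

theorem prefixProdSum_nonneg {L : List ℝ} (h : ∀ q ∈ L, 0 ≤ q) : 0 ≤ prefixProdSum L :=
  Finset.sum_nonneg fun _ _ => List.prod_nonneg fun q hq => h q (List.mem_of_mem_take hq)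

theorem prefixProdSum_lt {Q : ℝ} (hQ0 : 0 < Q) (hQ1 : Q < 1) {L : List ℝ}
    (h : ∀ q ∈ L, 0 ≤ q ∧ q ≤ Q) : prefixProdSum L < Q / (1 - Q) := by
  have h1 : 0 < 1 - Q := by linarith
  induction L with
  | nil => simpa [prefixProdSum] using div_pos hQ0 h1
  | cons a L ih =>
    have ih := ih fun q hq => h q (List.mem_cons_of_mem _ hq)
    have ha := h a List.mem_cons_self
    have h0 : 0 ≤ prefixProdSum L :=
      prefixProdSum_nonneg fun q hq => (h q (List.mem_cons_of_mem _ hq)).1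
    rw [prefixProdSum_cons]
    have e : Q / (1 - Q) = Q * (1 + Q / (1 - Q)) := by field_simp; ring
    rw [e]
    calc a * (1 + prefixProdSum L) ≤ Q * (1 + prefixProdSum L) := by gcongr; exact ha.2
      _ < Q * (1 + Q / (1 - Q)) := by gcongr

/-- The left side is the geometric sum Q + ⋯ + Q^n, and the tail `L` contributes only nonnegative
terms. -/
theorem le_prefixProdSum_replicate_append {Q : ℝ} (hQ0 : 0 ≤ Q) (hQ1 : Q < 1) (n : ℕ) {L : List ℝ}
    (h : ∀ q ∈ L, 0 ≤ q) :
    Q / (1 - Q) * (1 - Q ^ n) ≤ prefixProdSum (List.replicate n Q ++ L) := by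
  have h1 : 1 - Q ≠ 0 := by linarith
  induction n with
  | zero => simpa using prefixProdSum_nonneg h
  | succ n ih =>
    rw [List.replicate_succ, List.cons_append, prefixProdSum_cons]
    have e : Q / (1 - Q) * (1 - Q ^ (n + 1)) = Q * (1 + Q / (1 - Q) * (1 - Q ^ n)) := by
      field_simp; ring
    rw [e]
    gcongr

theorem heterogeneousRate_eq {U : Type} [Fintype U] {M : U → ℝ} {N Ka Kb : ℕ} {ma mb : ℝ}
    (hab : ma ≤ mb)
    (hM : (Finset.univ.val.map M : Multiset ℝ) =
      Multiset.replicate Ka ma + Multiset.replicate Kb mb) :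
    heterogeneousRate M N = prefixProdSum
      (List.replicate Ka (1 - ma / N) ++ List.replicate Kb (1 - mb / N)) := by
  have hsort : (Finset.univ.val.map M : Multiset ℝ).sort (· ≤ ·) =
      List.replicate Ka ma ++ List.replicate Kb mb := by
    refine List.Perm.eq_of_pairwise' (Multiset.pairwise_sort _ _) ?_ ?_
    · rw [List.pairwise_append]
      refine ⟨List.pairwise_replicate.2 (Or.inr le_rfl), List.pairwise_replicate.2 (Or.inr le_rfl),
        fun a ha b hb => ?_⟩
      rw [List.eq_of_mem_replicate ha, List.eq_of_mem_replicate hb]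
      exact hab
    · rw [← Multiset.coe_eq_coe, Multiset.sort_eq, hM]
      rfl
  unfold heterogeneousRate prefixProdSum
  simp only [hsort]
  have : List.replicate Ka (1 - ma / (N : ℝ)) ++ List.replicate Kb (1 - mb / (N : ℝ)) =
      (List.replicate Ka ma ++ List.replicate Kb mb).map fun m : ℝ => 1 - m / (N : ℝ) := by
    simp
  rw [this, List.length_map]
  simp only [← List.map_take]

theorem heterogeneousRate_bounds {U : Type} [Fintype U] {M : U → ℝ} {N Ka Kb ta tb : ℕ}
    {ma mb : ℝ} (hab : ma ≤ mb)
    (hM : (Finset.univ.val.map M : Multiset ℝ) =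
      Multiset.replicate Ka ma + Multiset.replicate Kb mb) (hN : 0 < N)
    (hta : 1 ≤ ta) (htKa : ta < Ka) (htKb : tb < Kb)
    (ha : (ta : ℝ) = Ka * ma / N) (hb : (tb : ℝ) = Kb * mb / N) :
    heterogeneousRate M N < ((Ka : ℝ) - ta) / ta ∧
      ((Ka : ℝ) - ta) / ta < 2 * heterogeneousRate M N := by
  rw [heterogeneousRate_eq hab hM]
  have hN' : (0 : ℝ) < N := by exact_mod_cast hN
  have hKa : (0 : ℝ) < Ka := by exact_mod_cast (by omega : 0 < Ka)
  have hKb : (0 : ℝ) < Kb := by exact_mod_cast (by omega : 0 < Kb)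
  have hta0 : (0 : ℝ) < ta := by exact_mod_cast hta
  have htKa' : (ta : ℝ) < Ka := by exact_mod_cast htKa
  have htKb' : (tb : ℝ) < Kb := by exact_mod_cast htKb
  have ea : ma / N = ta / Ka := by rw [ha]; field_simp
  have eb : mb / N = tb / Kb := by rw [hb]; field_simp
  have hqb : 0 ≤ 1 - mb / N := by
    rw [eb, sub_nonneg, div_le_one hKb]; exact htKb'.le
  have hqab : 1 - mb / (N : ℝ) ≤ 1 - ma / N := by gcongr
  have hqa0 : 0 < 1 - ma / (N : ℝ) := by
    rw [ea, sub_pos, div_lt_one hKa]; exact htKa'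
  have hqa1 : 1 - ma / (N : ℝ) < 1 := by
    rw [ea]; have : (0 : ℝ) < ta / Ka := by positivity
    linarith
  have hdiv : (1 - ma / (N : ℝ)) / (1 - (1 - ma / N)) = (Ka - ta) / ta := by
    rw [ea, sub_sub_cancel]; field_simp
  have hpos : 0 < ((Ka : ℝ) - ta) / ta := div_pos (by linarith) hta0
  constructor
  · rw [← hdiv]
    refine prefixProdSum_lt hqa0 hqa1 fun q hq => ?_
    rcases List.mem_append.1 hq with hq | hq
    · rw [List.eq_of_mem_replicate hq]; exact ⟨hqa0.le, le_rfl⟩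
    · rw [List.eq_of_mem_replicate hq]; exact ⟨hqb, hqab⟩
  · have hlow := le_prefixProdSum_replicate_append hqa0.le hqa1 Ka
      (L := List.replicate Kb (1 - mb / (N : ℝ)))
      (fun q hq => by rw [List.eq_of_mem_replicate hq]; exact hqb)
    rw [hdiv] at hlow
    -- (1 - t/K)^K ≤ e^(-t) ≤ e^(-1) < 1/2, so the first `Ka` terms make up more than half of the
    -- infinite series.
    have hpow : (1 - ma / (N : ℝ)) ^ Ka < 1 / 2 := by
      calc (1 - ma / (N : ℝ)) ^ Ka ≤ Real.exp (-(ma / N)) ^ Ka := by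
            gcongr; exact Real.one_sub_le_exp_neg _
        _ = Real.exp (-ta) := by
            rw [← Real.exp_nat_mul, ea]; congr 1; field_simp
        _ ≤ Real.exp (-1) := by
            gcongr; exact_mod_cast hta
        _ < 1 / 2 := by
            rw [Real.exp_neg, inv_eq_one_div]
            exact one_div_lt_one_div_of_lt (by norm_num) (by linarith [Real.exp_one_gt_d9])
    nlinarith

/-! ### Subset counts and existence of the saturating matchings -/

namespace CSM

theorem card_kSubset (K t : ℕ) : Nat.card (KSubset K t) = K.choose t := by
  rw [Nat.card_eq_fintype_card, Fintype.card_finset_len, Fintype.card_fin]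

theorem card_kSubset_mem {K t : ℕ} (ht : 1 ≤ t) (k : Fin K) :
    K * Nat.card {A : KSubset K t // k ∈ A.1} = t * K.choose t := by
  classical
  obtain ⟨t, rfl⟩ : ∃ t', t = t' + 1 := ⟨t - 1, by omega⟩
  obtain ⟨K, rfl⟩ : ∃ K', K = K' + 1 := ⟨K - 1, by have := k.2; omega⟩
  have e : Nat.card {A : KSubset (K + 1) (t + 1) // k ∈ A.1} =
      ((Finset.powersetCard (t + 1) Finset.univ).filter fun A => k ∈ A).card := by
    rw [← Nat.card_eq_finsetCard]
    exact Nat.card_congr ((Equiv.subtypeSubtypeEquivSubtypeInter _ fun A => k ∈ A).trans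
      (Equiv.subtypeEquivRight fun A => by simp [Finset.mem_powersetCard]))
  have h2 : (Finset.powersetCard (t + 1) Finset.univ).filter (fun A => k ∉ A) =
      Finset.powersetCard (t + 1) (Finset.univ.erase k) := by
    ext A
    simp [Finset.mem_powersetCard, Finset.subset_erase, and_comm]
  have h3 := Finset.card_filter_add_card_filter_not (s := Finset.powersetCard (t + 1) Finset.univ)
    fun A => k ∈ A
  rw [h2, Finset.card_powersetCard, Finset.card_powersetCard, Finset.card_erase_of_mem
    (Finset.mem_univ k), Finset.card_univ, Fintype.card_fin, Nat.add_sub_cancel,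
    Nat.choose_succ_succ, add_left_inj, ← e] at h3
  rw [h3, Nat.add_one_mul_choose_eq, mul_comm]

theorem nth_mem {K t : ℕ} (S : KSubset K (t + 1)) (m : Fin (t + 1)) : nth S m ∈ S.1 :=
  Finset.orderEmbOfFin_mem S.1 S.2 m

theorem nth_injective {K t : ℕ} (S : KSubset K (t + 1)) : Function.Injective (nth S) :=
  (S.1.orderEmbOfFin S.2).injective

theorem exists_nth_eq {K t : ℕ} (S : KSubset K (t + 1)) {k : Fin K} (hk : k ∈ S.1) :
    ∃ m, nth S m = k := by
  have : k ∈ Set.range (S.1.orderEmbOfFin S.2) := by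
    rw [Finset.range_orderEmbOfFin]; exact hk
  exact this

theorem nth_notMem_remove {K t : ℕ} (S : KSubset K (t + 1)) (m : Fin (t + 1)) :
    nth S m ∉ (remove S m).1 := Finset.notMem_erase _ _

theorem insert_nth_remove {K t : ℕ} (S : KSubset K (t + 1)) (m : Fin (t + 1)) :
    insert (nth S m) (remove S m).1 = S.1 := Finset.insert_erase (nth_mem S m)

theorem nth_mem_remove {K t : ℕ} (S : KSubset K (t + 1)) {i m : Fin (t + 1)} (h : i ≠ m) :
    nth S i ∈ (remove S m).1 :=
  Finset.mem_erase.2 ⟨fun e => h (nth_injective S e), nth_mem S i⟩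

theorem exists_remove_eq {K t : ℕ} (A : KSubset K t) {k : Fin K} (hk : k ∉ A.1) :
    ∃ (S : KSubset K (t + 1)) (m : Fin (t + 1)), nth S m = k ∧ remove S m = A := by
  let S : KSubset K (t + 1) := ⟨insert k A.1, by rw [Finset.card_insert_of_notMem hk, A.2]⟩
  obtain ⟨m, hm⟩ := exists_nth_eq S (Finset.mem_insert_self k A.1)
  refine ⟨S, m, hm, Subtype.ext ?_⟩
  change S.1.erase (nth S m) = A.1
  rw [hm]
  exact Finset.erase_insert hk

/-- A pair (S, m) over `A` amounts to the removed element, which may be any k outside `A`. This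
gives the fibre sizes of the graph. -/
theorem card_remove_eq {K t : ℕ} (A : KSubset K t) :
    Nat.card {p : KSubset K (t + 1) × Fin (t + 1) // remove p.1 p.2 = A} = K - t := by
  let f : {p : KSubset K (t + 1) × Fin (t + 1) // remove p.1 p.2 = A} → {k : Fin K // k ∉ A.1} :=
    fun p => ⟨nth p.1.1 p.1.2, fun h => nth_notMem_remove p.1.1 p.1.2 (by rwa [p.2])⟩
  have hf : Function.Bijective f := by
    constructor
    · rintro ⟨⟨S, m⟩, h⟩ ⟨⟨S', m'⟩, h'⟩ e
      have e : nth S m = nth S' m' := congrArg Subtype.val e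
      have hS : S = S' := Subtype.ext <| by
        rw [← insert_nth_remove S m, ← insert_nth_remove S' m', e]
        rw [show remove S m = A from h, show remove S' m' = A from h']
      subst hS
      obtain rfl := nth_injective S e
      rfl
    · rintro ⟨k, hk⟩
      obtain ⟨S, m, h1, h2⟩ := exists_remove_eq A hk
      exact ⟨⟨(S, m), h2⟩, Subtype.ext h1⟩
  rw [Nat.card_congr (Equiv.ofBijective f hf), Nat.card_eq_fintype_card, Fintype.card_subtype_compl]
  simp [A.2]

variable {K₁ K₂ t₁ t₂ : ℕ}

theorem card_fin_val_lt {n c : ℕ} (h : c ≤ n) : Nat.card {l : Fin n // l.1 < c} = c := by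
  have e : {l : Fin n // l.1 < c} ≃ Fin c :=
    ⟨fun l => ⟨l.1.1, l.2⟩, fun l => ⟨⟨l.1, l.2.trans_le h⟩, l.2⟩, fun _ => rfl, fun _ => rfl⟩
  rw [Nat.card_congr e, Nat.card_fin]

/-- The set `A` and the set `B` common to `X^{(l₂, m₁)}_{S₁, B}` and its neighbours. -/
def XVertex.base (x : XVertex K₁ K₂ t₁ t₂) : KSubset K₁ t₁ × KSubset K₂ t₂ :=
  (remove x.S₁ x.m₁, x.B)

/-- The set `A` and the set `B` common to `Y^{(m₂, l₁)}_{A, S₂}` and its neighbours. -/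
def YVertex.base (y : YVertex K₁ K₂ t₁ t₂) : KSubset K₁ t₁ × KSubset K₂ t₂ :=
  (y.A, remove y.S₂ y.m₂)

theorem adjacent_iff_base_eq {x : XVertex K₁ K₂ t₁ t₂} {y : YVertex K₁ K₂ t₁ t₂} :
    Adjacent x y ↔ x.base = y.base := by
  rw [Adjacent, XVertex.base, YVertex.base, Prod.mk.injEq, @eq_comm _ (remove y.S₂ y.m₂)]

theorem card_xVertex_base_eq {c : ℕ} (hc : c ≤ t₂) (AB : KSubset K₁ t₁ × KSubset K₂ t₂) :
    Nat.card {x : {x : XVertex K₁ K₂ t₁ t₂ // x.l₂.1 < c} // x.1.base = AB} = (K₁ - t₁) * c := by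
  obtain ⟨A, B⟩ := AB
  have e : {x : {x : XVertex K₁ K₂ t₁ t₂ // x.l₂.1 < c} // x.1.base = (A, B)} ≃
      {p : KSubset K₁ (t₁ + 1) × Fin (t₁ + 1) // remove p.1 p.2 = A} × {l : Fin t₂ // l.1 < c} :=
    { toFun := fun x => (⟨(x.1.1.S₁, x.1.1.m₁), (Prod.mk.inj x.2).1⟩, ⟨x.1.1.l₂, x.1.2⟩)
      invFun := fun q => ⟨⟨⟨q.1.1.1, B, q.2.1, q.1.1.2⟩, q.2.2⟩, Prod.ext q.1.2 rfl⟩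
      left_inv := by
        rintro ⟨⟨⟨S, B', l, m⟩, hl⟩, h⟩
        obtain rfl : B' = B := (Prod.mk.inj h).2
        rfl
      right_inv := fun _ => rfl }
  rw [Nat.card_congr e, Nat.card_prod, card_remove_eq, card_fin_val_lt hc]

theorem card_yVertex_base_eq {c : ℕ} (hc : c ≤ t₁) (AB : KSubset K₁ t₁ × KSubset K₂ t₂) :
    Nat.card {y : {y : YVertex K₁ K₂ t₁ t₂ // y.l₁.1 < c} // y.1.base = AB} = (K₂ - t₂) * c := by
  obtain ⟨A, B⟩ := AB
  have e : {y : {y : YVertex K₁ K₂ t₁ t₂ // y.l₁.1 < c} // y.1.base = (A, B)} ≃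
      {p : KSubset K₂ (t₂ + 1) × Fin (t₂ + 1) // remove p.1 p.2 = B} × {l : Fin t₁ // l.1 < c} :=
    { toFun := fun y => (⟨(y.1.1.S₂, y.1.1.m₂), (Prod.mk.inj y.2).2⟩, ⟨y.1.1.l₁, y.1.2⟩)
      invFun := fun q => ⟨⟨⟨A, q.1.1.1, q.1.1.2, q.2.1⟩, q.2.2⟩, Prod.ext rfl q.1.2⟩
      left_inv := by
        rintro ⟨⟨⟨A', S, m, l⟩, hl⟩, h⟩
        obtain rfl : A' = A := (Prod.mk.inj h).1
        rfl
      right_inv := fun _ => rfl }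
  rw [Nat.card_congr e, Nat.card_prod, card_remove_eq, card_fin_val_lt hc]

/-- The hypothesis says that the caches of group b are no larger than those of group a. It ensures
that the levels below c are available among the `ta` levels. -/
theorem ceil_le_of_cross_le {Ka Kb ta tb : ℕ} (hKb : tb < Kb)
    (h : tb * Ka ≤ ta * Kb) : ⌈(tb * (Ka - ta) : ℝ) / (Kb - tb)⌉₊ ≤ ta := by
  have hb : (0 : ℝ) < Kb - tb := sub_pos.2 (by exact_mod_cast hKb)
  rw [Nat.ceil_le, div_le_iff₀ hb]
  have : (tb * Ka : ℝ) ≤ ta * Kb := by exact_mod_cast h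
  linarith

theorem mul_le_mul_ceil {Ka Kb ta tb : ℕ} (hKa : ta < Ka) (hKb : tb < Kb) :
    (Ka - ta) * tb ≤ (Kb - tb) * ⌈(tb * (Ka - ta) : ℝ) / (Kb - tb)⌉₊ := by
  have hb : (0 : ℝ) < Kb - tb := sub_pos.2 (by exact_mod_cast hKb)
  have := (div_le_iff₀ hb).1 (Nat.le_ceil ((tb * (Ka - ta) : ℝ) / (Kb - tb)))
  have h' : (((Ka - ta : ℕ) * tb : ℕ) : ℝ) ≤
      (((Kb - tb : ℕ) * ⌈(tb * (Ka - ta) : ℝ) / (Kb - tb)⌉₊ : ℕ) : ℝ) := by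
    rw [Nat.cast_mul, Nat.cast_mul, Nat.cast_sub hKa.le, Nat.cast_sub hKb.le]
    linarith
  exact_mod_cast h'

/-- Over each base (A, B) there are (K₁ - t₁)t₂ vertices X and (K₂ - t₂)c vertices Y (for M₁ ≥ M₂),
all mutually adjacent, so comparing these counts replaces Hall's condition. -/
theorem nonempty_saturatingMatching {M₁ M₂ : ℝ} (htK₁ : t₁ < K₁) (htK₂ : t₂ < K₂)
    (hge : M₁ ≥ M₂ → t₂ * K₁ ≤ t₁ * K₂) (hlt : M₁ < M₂ → t₁ * K₂ ≤ t₂ * K₁) :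
    Nonempty (SaturatingMatching K₁ K₂ t₁ t₂ M₁ M₂) := by
  by_cases hM : M₁ ≥ M₂
  · have hx : xBound K₁ K₂ t₁ t₂ M₁ M₂ = t₂ := if_pos hM
    have hy : yBound K₁ K₂ t₁ t₂ M₁ M₂ = ⌈(t₂ * (K₁ - t₁) : ℝ) / (K₂ - t₂)⌉₊ := if_pos hM
    have hyt : yBound K₁ K₂ t₁ t₂ M₁ M₂ ≤ t₁ := hy ▸ ceil_le_of_cross_le htK₂ (hge hM)
    obtain ⟨f, hf, hbase⟩ := exists_injective_of_card_fiber_le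
      (fun x : {x : XVertex K₁ K₂ t₁ t₂ // x.l₂.1 < t₂} => x.1.base)
      (fun y : {y : YVertex K₁ K₂ t₁ t₂ // y.l₁.1 < yBound K₁ K₂ t₁ t₂ M₁ M₂} => y.1.base)
      (fun AB => by
        rw [card_xVertex_base_eq le_rfl, card_yVertex_base_eq hyt, hy]
        exact mul_le_mul_ceil htK₁ htK₂)
    refine ⟨⟨Set.range fun x => (x.1, (f x).1), ?_, ?_, ?_, ?_, ?_, ?_, fun h => absurd hM h.not_ge⟩⟩
    · rintro _ ⟨x, rfl⟩
      exact adjacent_iff_base_eq.2 (hbase x).symm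
    · rintro _ ⟨x, rfl⟩
      rw [hx]; exact x.2
    · rintro _ ⟨x, rfl⟩
      exact (f x).2
    · rintro _ ⟨x, rfl⟩ _ ⟨x', rfl⟩ h
      rw [show x = x' from Subtype.ext h]
    · rintro _ ⟨x, rfl⟩ _ ⟨x', rfl⟩ h
      rw [hf (Subtype.ext h)]
    · exact fun _ x => ⟨_, ⟨⟨x, x.l₂.2⟩, rfl⟩, rfl⟩
  · have hy : yBound K₁ K₂ t₁ t₂ M₁ M₂ = t₁ := if_neg hM
    have hx : xBound K₁ K₂ t₁ t₂ M₁ M₂ = ⌈(t₁ * (K₂ - t₂) : ℝ) / (K₁ - t₁)⌉₊ := if_neg hM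
    have hxt : xBound K₁ K₂ t₁ t₂ M₁ M₂ ≤ t₂ :=
      hx ▸ ceil_le_of_cross_le htK₁ (hlt (not_le.1 hM))
    obtain ⟨f, hf, hbase⟩ := exists_injective_of_card_fiber_le
      (fun y : {y : YVertex K₁ K₂ t₁ t₂ // y.l₁.1 < t₁} => y.1.base)
      (fun x : {x : XVertex K₁ K₂ t₁ t₂ // x.l₂.1 < xBound K₁ K₂ t₁ t₂ M₁ M₂} => x.1.base)
      (fun AB => by
        rw [card_yVertex_base_eq le_rfl, card_xVertex_base_eq hxt, hx]
        exact mul_le_mul_ceil htK₂ htK₁)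
    refine ⟨⟨Set.range fun y => ((f y).1, y.1), ?_, ?_, ?_, ?_, ?_, fun h => absurd h hM, ?_⟩⟩
    · rintro _ ⟨y, rfl⟩
      exact adjacent_iff_base_eq.2 (hbase y)
    · rintro _ ⟨y, rfl⟩
      exact (f y).2
    · rintro _ ⟨y, rfl⟩
      rw [hy]; exact y.2
    · rintro _ ⟨y, rfl⟩ _ ⟨y', rfl⟩ h
      rw [hf (Subtype.ext h)]
    · rintro _ ⟨y, rfl⟩ _ ⟨y', rfl⟩ h
      rw [show y = y' from Subtype.ext h]
    · exact fun _ y => ⟨_, ⟨⟨y, y.l₁.2⟩, rfl⟩, rfl⟩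

/-! ### Sizes -/

theorem card_subPacket (K₁ K₂ t₁ t₂ : ℕ) : Nat.card (SubPacket K₁ K₂ t₁ t₂) =
    K₁.choose t₁ * (K₂.choose t₂ * (t₂ * t₁)) := by
  have e : SubPacket K₁ K₂ t₁ t₂ ≃ KSubset K₁ t₁ × KSubset K₂ t₂ × Fin t₂ × Fin t₁ :=
    ⟨fun p => (p.A, p.B, p.l₂, p.l₁), fun q => ⟨q.1, q.2.1, q.2.2.1, q.2.2.2⟩,
      fun _ => rfl, fun _ => rfl⟩
  simp only [Nat.card_congr e, Nat.card_prod, card_kSubset, Nat.card_fin]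

theorem card_xVertex (K₁ K₂ t₁ t₂ : ℕ) : Nat.card (XVertex K₁ K₂ t₁ t₂) =
    K₁.choose (t₁ + 1) * (K₂.choose t₂ * (t₂ * (t₁ + 1))) := by
  have e : XVertex K₁ K₂ t₁ t₂ ≃ KSubset K₁ (t₁ + 1) × KSubset K₂ t₂ × Fin t₂ × Fin (t₁ + 1) :=
    ⟨fun p => (p.S₁, p.B, p.l₂, p.m₁), fun q => ⟨q.1, q.2.1, q.2.2.1, q.2.2.2⟩,
      fun _ => rfl, fun _ => rfl⟩
  simp only [Nat.card_congr e, Nat.card_prod, card_kSubset, Nat.card_fin]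

theorem card_yVertex (K₁ K₂ t₁ t₂ : ℕ) : Nat.card (YVertex K₁ K₂ t₁ t₂) =
    K₁.choose t₁ * (K₂.choose (t₂ + 1) * ((t₂ + 1) * t₁)) := by
  have e : YVertex K₁ K₂ t₁ t₂ ≃ KSubset K₁ t₁ × KSubset K₂ (t₂ + 1) × Fin (t₂ + 1) × Fin t₁ :=
    ⟨fun p => (p.A, p.S₂, p.m₂, p.l₁), fun q => ⟨q.1, q.2.1, q.2.2.1, q.2.2.2⟩,
      fun _ => rfl, fun _ => rfl⟩
  simp only [Nat.card_congr e, Nat.card_prod, card_kSubset, Nat.card_fin]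

theorem card_stores_inl (ht₁ : 1 ≤ t₁) (k : Fin K₁) :
    K₁ * Nat.card {p : SubPacket K₁ K₂ t₁ t₂ // Stores (Sum.inl k) p} =
      t₁ * Nat.card (SubPacket K₁ K₂ t₁ t₂) := by
  have e : {p : SubPacket K₁ K₂ t₁ t₂ // Stores (Sum.inl k) p} ≃
      {A : KSubset K₁ t₁ // k ∈ A.1} × KSubset K₂ t₂ × Fin t₂ × Fin t₁ :=
    ⟨fun p => (⟨p.1.A, p.2⟩, p.1.B, p.1.l₂, p.1.l₁),
      fun q => ⟨⟨q.1.1, q.2.1, q.2.2.1, q.2.2.2⟩, q.1.2⟩, fun _ => rfl, fun _ => rfl⟩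
  rw [Nat.card_congr e, Nat.card_prod, ← mul_assoc, card_kSubset_mem ht₁, card_subPacket]
  simp only [Nat.card_prod, card_kSubset, Nat.card_fin, mul_assoc]

theorem card_stores_inr (ht₂ : 1 ≤ t₂) (k : Fin K₂) :
    K₂ * Nat.card {p : SubPacket K₁ K₂ t₁ t₂ // Stores (Sum.inr k) p} =
      t₂ * Nat.card (SubPacket K₁ K₂ t₁ t₂) := by
  have e : {p : SubPacket K₁ K₂ t₁ t₂ // Stores (Sum.inr k) p} ≃
      {B : KSubset K₂ t₂ // k ∈ B.1} × KSubset K₁ t₁ × Fin t₂ × Fin t₁ :=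
    ⟨fun p => (⟨p.1.B, p.2⟩, p.1.A, p.1.l₂, p.1.l₁),
      fun q => ⟨⟨q.2.1, q.1.1, q.2.2.1, q.2.2.2⟩, q.1.2⟩, fun _ => rfl, fun _ => rfl⟩
  rw [Nat.card_congr e, Nat.card_prod, ← mul_assoc, card_kSubset_mem ht₂, card_subPacket]
  simp only [Nat.card_prod, card_kSubset, Nat.card_fin]
  ring

/-- Each packet is charged to a vertex Y: an edge to its endpoint, an unmatched Y to itself, the sum
of Y^(j) and Y^(j+1) to Y^(j). The first two kinds have l₁ < c and the third l₁ ≥ c. Saturation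
leaves nothing to send on the X side. -/
theorem card_sent_le_yVertex {M₁ M₂ : ℝ} (hM : M₁ ≥ M₂)
    (m : SaturatingMatching K₁ K₂ t₁ t₂ M₁ M₂) :
    Nat.card (Sent m) ≤ Nat.card (YVertex K₁ K₂ t₁ t₂) := by
  have hx : xBound K₁ K₂ t₁ t₂ M₁ M₂ = t₂ := if_pos hM
  have : IsEmpty (XDirect m) := ⟨fun x => by
    obtain ⟨e, he, h⟩ := m.saturates_x hM x.1
    exact x.2.2 e he h⟩
  have : IsEmpty (XCoded K₁ K₂ t₁ t₂ M₁ M₂) := ⟨fun q => by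
    exact (hx.ge.trans q.2.2.1.2).not_gt q.2.2.1.1.2⟩
  let f : Sent m → YVertex K₁ K₂ t₁ t₂ := fun
    | .inl e => e.1.2
    | .inr (.inl x) => isEmptyElim x
    | .inr (.inr (.inl y)) => y.1
    | .inr (.inr (.inr (.inl q))) => isEmptyElim q
    | .inr (.inr (.inr (.inr (A, S₂, l₁, j)))) => ⟨A, S₂, j.castSucc, l₁.1⟩
  refine Nat.card_le_card_of_injective f ?_
  rintro (e | x | y | q | ⟨A, S, l, j⟩) (e' | x' | y' | q' | ⟨A', S', l', j'⟩) h <;>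
    first | exact isEmptyElim x | exact isEmptyElim q | exact isEmptyElim x' | exact isEmptyElim q'
          | skip
  · rw [Subtype.ext (m.y_inj e.1 e.2 e'.1 e'.2 h)]
  · exact absurd h (y'.2.2 e.1 e.2)
  · have h : e.1.2 = ⟨A', S', j'.castSucc, l'.1⟩ := h
    have := m.y_lt e.1 e.2
    rw [h] at this
    exact absurd this l'.2.not_gt
  · exact absurd h.symm (y.2.2 e'.1 e'.2)
  · rw [Subtype.ext (show y.1 = y'.1 from h)]
  · have h : y.1 = ⟨A', S', j'.castSucc, l'.1⟩ := h
    have := y.2.1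
    rw [h] at this
    exact absurd this l'.2.not_gt
  · have h : ⟨A, S, j.castSucc, l.1⟩ = e'.1.2 := h
    have := m.y_lt e'.1 e'.2
    rw [← h] at this
    exact absurd this l.2.not_gt
  · have h : ⟨A, S, j.castSucc, l.1⟩ = y'.1 := h
    have := y'.2.1
    rw [← h] at this
    exact absurd this l.2.not_gt
  · obtain ⟨h1, h2, h3, h4⟩ := YVertex.mk.inj h
    rw [h1, h2, Fin.castSucc_injective _ h3, Subtype.ext h4]

theorem card_sent_le_xVertex {M₁ M₂ : ℝ} (hM : M₁ < M₂)
    (m : SaturatingMatching K₁ K₂ t₁ t₂ M₁ M₂) :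
    Nat.card (Sent m) ≤ Nat.card (XVertex K₁ K₂ t₁ t₂) := by
  have hy : yBound K₁ K₂ t₁ t₂ M₁ M₂ = t₁ := if_neg hM.not_ge
  have : IsEmpty (YDirect m) := ⟨fun y => by
    obtain ⟨e, he, h⟩ := m.saturates_y hM y.1
    exact y.2.2 e he h⟩
  have : IsEmpty (YCoded K₁ K₂ t₁ t₂ M₁ M₂) := ⟨fun q => by
    exact (hy.ge.trans q.2.2.1.2).not_gt q.2.2.1.1.2⟩
  let f : Sent m → XVertex K₁ K₂ t₁ t₂ := fun
    | .inl e => e.1.1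
    | .inr (.inl x) => x.1
    | .inr (.inr (.inl y)) => isEmptyElim y
    | .inr (.inr (.inr (.inl (S₁, B, l₂, j)))) => ⟨S₁, B, l₂.1, j.castSucc⟩
    | .inr (.inr (.inr (.inr q))) => isEmptyElim q
  refine Nat.card_le_card_of_injective f ?_
  rintro (e | x | y | ⟨S, B, l, j⟩ | q) (e' | x' | y' | ⟨S', B', l', j'⟩ | q') h <;>
    first | exact isEmptyElim y | exact isEmptyElim q | exact isEmptyElim y' | exact isEmptyElim q'
          | skip
  · rw [Subtype.ext (m.x_inj e.1 e.2 e'.1 e'.2 h)]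
  · exact absurd h (x'.2.2 e.1 e.2)
  · have h : e.1.1 = ⟨S', B', l'.1, j'.castSucc⟩ := h
    have := m.x_lt e.1 e.2
    rw [h] at this
    exact absurd this l'.2.not_gt
  · exact absurd h.symm (x.2.2 e'.1 e'.2)
  · rw [Subtype.ext (show x.1 = x'.1 from h)]
  · have h : x.1 = ⟨S', B', l'.1, j'.castSucc⟩ := h
    have := x.2.1
    rw [h] at this
    exact absurd this l'.2.not_gt
  · have h : ⟨S, B, l.1, j.castSucc⟩ = e'.1.1 := h
    have := m.x_lt e'.1 e'.2
    rw [← h] at this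
    exact absurd this l.2.not_gt
  · have h : ⟨S, B, l.1, j.castSucc⟩ = x'.1 := h
    have := x'.2.1
    rw [← h] at this
    exact absurd this l.2.not_gt
  · obtain ⟨h1, h2, h3, h4⟩ := XVertex.mk.inj h
    rw [h1, h2, Fin.castSucc_injective _ h4, Subtype.ext h3]

/-! ### Decoding -/

/-- The common form of the coded packets `X^{(l₂, m₁)}_{S₁, B}` and `Y^{(m₂, l₁)}_{A, S₂}`; the
value `w k A l` is the sub-packet with index `(A, l)` of the file that user `k` requests. -/
def comb {K t : ℕ} {V : Type} [AddCommGroup V] (w : Fin K → KSubset K t → Fin t → V)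
    (S : KSubset K (t + 1)) (m : Fin (t + 1)) : V :=
  (∑ i : {i : Fin (t + 1) // i < m}, w (nth S i.1) (remove S i.1)
      ⟨m.1 - 1, by have := i.2; have := m.2; omega⟩) +
  ∑ i : {i : Fin (t + 1) // m < i}, w (nth S i.1) (remove S i.1)
      ⟨m.1, by have := i.2; have := i.1.2; omega⟩

theorem comb_congr {K t : ℕ} {V : Type} [AddCommGroup V] {w w' : Fin K → KSubset K t → Fin t → V}
    (S : KSubset K (t + 1)) (m : Fin (t + 1))
    (h : ∀ i, i ≠ m → ∀ l, w (nth S i) (remove S i) l = w' (nth S i) (remove S i) l) :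
    comb w S m = comb w' S m := by
  unfold comb
  congr 1
  · exact Finset.sum_congr rfl fun i _ => h _ i.2.ne _
  · exact Finset.sum_congr rfl fun i _ => h _ i.2.ne' _

/-- A user `k = k_i` that knows all summands except those requested by itself recovers these from
the coded packets. -/
theorem eq_of_comb_eq {K t : ℕ} {V : Type} [AddCommGroup V]
    {w w' : Fin K → KSubset K t → Fin t → V} (S : KSubset K (t + 1)) (i : Fin (t + 1))
    (h : ∀ i', i' ≠ i → ∀ l, w (nth S i') (remove S i') l = w' (nth S i') (remove S i') l)
    (hc : ∀ m, m ≠ i → comb w S m = comb w' S m) (l : Fin t) :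
    w (nth S i) (remove S i) l = w' (nth S i) (remove S i) l := by
  classical
  -- As m runs over the indices other than i, user k_i's own summand in packet m has level m if m <
  -- i and level m - 1 if m > i. So every level occurs exactly once: level l comes from m = l or
  -- from m = l + 1.
  by_cases hl : l.1 < i.1
  · have hm : l.castSucc < i := hl
    have hcl := hc l.castSucc hm.ne
    unfold comb at hcl
    rw [Finset.sum_congr rfl fun i' _ => h i'.1 (i'.2.trans hm).ne _, add_left_cancel_iff,
      ← Finset.add_sum_erase _ _ (Finset.mem_univ ⟨i, hm⟩),
      ← Finset.add_sum_erase _ _ (Finset.mem_univ ⟨i, hm⟩),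
      Finset.sum_congr rfl fun i' hi' => h i'.1
        (fun e => (Finset.mem_erase.1 hi').1 (Subtype.ext e)) _, add_right_cancel_iff] at hcl
    exact hcl
  · have hm : i < l.succ := by
      rw [Fin.lt_def, Fin.val_succ]; omega
    have hcl := hc l.succ hm.ne'
    unfold comb at hcl
    rw [Finset.sum_congr (s₁ := (Finset.univ : Finset {i' : Fin (t + 1) // l.succ < i'})) rfl
        fun i' _ => h i'.1 (hm.trans i'.2).ne' _, add_right_cancel_iff,
      ← Finset.add_sum_erase _ _ (Finset.mem_univ ⟨i, hm⟩),
      ← Finset.add_sum_erase _ _ (Finset.mem_univ ⟨i, hm⟩),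
      Finset.sum_congr rfl fun i' hi' => h i'.1
        (fun e => (Finset.mem_erase.1 hi').1 (Subtype.ext e)) _, add_right_cancel_iff] at hcl
    exact hcl

/-- Each consecutive sum makes agreement at j equivalent to agreement at j + 1, so one known term
determines the whole chain. -/
theorem eq_of_consecutive_add_eq {t : ℕ} {V : Type} [AddCommGroup V] {f g : Fin (t + 1) → V}
    (i : Fin (t + 1)) (hi : f i = g i)
    (h : ∀ j : Fin t, f j.castSucc + f j.succ = g j.castSucc + g j.succ) (m : Fin (t + 1)) :
    f m = g m := by
  have iff_succ : ∀ j : Fin t, f j.castSucc = g j.castSucc ↔ f j.succ = g j.succ := fun j =>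
    ⟨fun e => by have := h j; rwa [e, add_left_cancel_iff] at this,
      fun e => by have := h j; rwa [e, add_right_cancel_iff] at this⟩
  have iff_zero : ∀ m : Fin (t + 1), f m = g m ↔ f 0 = g 0 := fun m => by
    induction m using Fin.induction with
    | zero => rfl
    | succ j ih => rw [← iff_succ, ih]
  rw [iff_zero, ← iff_zero i, hi]

section

variable {N : ℕ} {M₁ M₂ : ℝ} {V : Type} [AddCommGroup V]
  {m : SaturatingMatching K₁ K₂ t₁ t₂ M₁ M₂} {d : User K₁ K₂ → Fin N}
  {W W' : Fin N → SubPacket K₁ K₂ t₁ t₂ → V}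

theorem xValue_eq_comb (x : XVertex K₁ K₂ t₁ t₂) :
    xValue d W x = comb (fun k A l => W (d (Sum.inl k)) ⟨A, x.B, x.l₂, l⟩) x.S₁ x.m₁ := rfl

theorem yValue_eq_comb (y : YVertex K₁ K₂ t₁ t₂) :
    yValue d W y = comb (fun k B l => W (d (Sum.inr k)) ⟨y.A, B, l, y.l₁⟩) y.S₂ y.m₂ := rfl

/-- Only cancellation is used, so the argument holds in every abelian group and not just for bit
strings. -/
theorem recover_inl (k : Fin K₁)
    (hp : ∀ n p, Stores (Sum.inl k : User K₁ K₂) p → W n p = W' n p)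
    (hs : deliver m d W = deliver m d W') : W (d (Sum.inl k)) = W' (d (Sum.inl k)) := by
  funext ⟨A, B, l₂, l₁⟩
  by_cases hk : k ∈ A.1
  · exact hp _ _ hk
  obtain ⟨S, i, rfl, rfl⟩ := exists_remove_eq A hk
  have hknown : ∀ i', i' ≠ i → ∀ l : Fin t₁, W (d (Sum.inl (nth S i'))) ⟨remove S i', B, l₂, l⟩ =
      W' (d (Sum.inl (nth S i'))) ⟨remove S i', B, l₂, l⟩ := fun i' h l =>
    hp _ _ (nth_mem_remove S h.symm)
  refine eq_of_comb_eq (w := fun k A l => W (d (Sum.inl k)) ⟨A, B, l₂, l⟩)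
    (w' := fun k A l => W' (d (Sum.inl k)) ⟨A, B, l₂, l⟩) S i hknown (fun j hj => ?_) l₁
  change xValue d W ⟨S, B, l₂, j⟩ = xValue d W' ⟨S, B, l₂, j⟩
  by_cases hl : l₂.1 < xBound K₁ K₂ t₁ t₂ M₁ M₂
  · by_cases he : ∃ e ∈ m.edges, e.1 = ⟨S, B, l₂, j⟩
    · obtain ⟨e, he, hx⟩ := he
      have h : xValue d W e.1 + yValue d W e.2 = xValue d W' e.1 + yValue d W' e.2 :=
        congrFun hs (Sum.inl ⟨e, he⟩)
      -- As j ≠ i, user k_i remains in S \ {k_j}, which is the set A of the partner Y. Hence every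
      -- summand of Y is in its cache.
      have hA : remove S j = e.2.A := by
        have := (m.adjacent e he).1
        rwa [hx] at this
      have hy : yValue d W e.2 = yValue d W' e.2 := by
        rw [yValue_eq_comb, yValue_eq_comb]
        refine comb_congr _ _ fun i' _ l => hp _ _ ?_
        change nth S i ∈ e.2.A.1
        rw [← hA]
        exact nth_mem_remove S hj.symm
      rw [hy, add_right_cancel_iff, hx] at h
      exact h
    · push Not at he
      exact congrFun hs (Sum.inr (Sum.inl ⟨⟨S, B, l₂, j⟩, hl, he⟩))
  -- The vertex with m₁ = i omits the summand requested by k_i, so this user can compute it from its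
  -- cache. It starts the chain of consecutive sums.
  · refine eq_of_consecutive_add_eq (f := fun j => xValue d W ⟨S, B, l₂, j⟩)
      (g := fun j => xValue d W' ⟨S, B, l₂, j⟩) i ?_ (fun j' => ?_) j
    · exact comb_congr (w := fun k A l => W (d (Sum.inl k)) ⟨A, B, l₂, l⟩)
        (w' := fun k A l => W' (d (Sum.inl k)) ⟨A, B, l₂, l⟩) S i hknown
    · exact congrFun hs (Sum.inr (Sum.inr (Sum.inr (Sum.inl (S, B, ⟨l₂, not_lt.1 hl⟩, j')))))

theorem recover_inr (k : Fin K₂)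
    (hp : ∀ n p, Stores (Sum.inr k : User K₁ K₂) p → W n p = W' n p)
    (hs : deliver m d W = deliver m d W') : W (d (Sum.inr k)) = W' (d (Sum.inr k)) := by
  funext ⟨A, B, l₂, l₁⟩
  by_cases hk : k ∈ B.1
  · exact hp _ _ hk
  obtain ⟨S, i, rfl, rfl⟩ := exists_remove_eq B hk
  have hknown : ∀ i', i' ≠ i → ∀ l : Fin t₂, W (d (Sum.inr (nth S i'))) ⟨A, remove S i', l, l₁⟩ =
      W' (d (Sum.inr (nth S i'))) ⟨A, remove S i', l, l₁⟩ := fun i' h l =>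
    hp _ _ (nth_mem_remove S h.symm)
  refine eq_of_comb_eq (w := fun k B l => W (d (Sum.inr k)) ⟨A, B, l, l₁⟩)
    (w' := fun k B l => W' (d (Sum.inr k)) ⟨A, B, l, l₁⟩) S i hknown (fun j hj => ?_) l₂
  change yValue d W ⟨A, S, j, l₁⟩ = yValue d W' ⟨A, S, j, l₁⟩
  by_cases hl : l₁.1 < yBound K₁ K₂ t₁ t₂ M₁ M₂
  · by_cases he : ∃ e ∈ m.edges, e.2 = ⟨A, S, j, l₁⟩
    · obtain ⟨e, he, hy⟩ := he
      have h : xValue d W e.1 + yValue d W e.2 = xValue d W' e.1 + yValue d W' e.2 :=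
        congrFun hs (Sum.inl ⟨e, he⟩)
      have hB : remove S j = e.1.B := by
        have := (m.adjacent e he).2
        rwa [hy] at this
      have hx : xValue d W e.1 = xValue d W' e.1 := by
        rw [xValue_eq_comb, xValue_eq_comb]
        refine comb_congr _ _ fun i' _ l => hp _ _ ?_
        change nth S i ∈ e.1.B.1
        rw [← hB]
        exact nth_mem_remove S hj.symm
      rw [hx, add_left_cancel_iff, hy] at h
      exact h
    · push Not at he
      exact congrFun hs (Sum.inr (Sum.inr (Sum.inl ⟨⟨A, S, j, l₁⟩, hl, he⟩)))
  · refine eq_of_consecutive_add_eq (f := fun j => yValue d W ⟨A, S, j, l₁⟩)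
      (g := fun j => yValue d W' ⟨A, S, j, l₁⟩) i ?_ (fun j' => ?_) j
    · exact comb_congr (w := fun k B l => W (d (Sum.inr k)) ⟨A, B, l, l₁⟩)
        (w' := fun k B l => W' (d (Sum.inr k)) ⟨A, B, l, l₁⟩) S i hknown
    · exact congrFun hs (Sum.inr (Sum.inr (Sum.inr (Sum.inr (A, S, ⟨l₁, not_lt.1 hl⟩, j')))))

end

/-! ### Validity and rate of the proposed scheme -/

theorem scheme_isValid {N : ℕ} {M₁ M₂ : ℝ} (hN : 0 < N) (hM₁ : (t₁ : ℝ) = K₁ * M₁ / N)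
    (hM₂ : (t₂ : ℝ) = K₂ * M₂ / N) (ht₁ : 1 ≤ t₁) (htK₁ : t₁ < K₁) (ht₂ : 1 ≤ t₂)
    (htK₂ : t₂ < K₂) (b : ℕ) (hb : 1 ≤ b)
    (m : (User K₁ K₂ → Fin N) → SaturatingMatching K₁ K₂ t₁ t₂ M₁ M₂) :
    (scheme N ht₁ htK₁ ht₂ htK₂ b hb m).IsValid (cacheSize K₁ K₂ M₁ M₂) := by
  have hN' : (0 : ℝ) < N := by exact_mod_cast hN
  have size : ∀ {K t c F : ℕ} {M : ℝ}, 0 < K → (t : ℝ) = K * M / N → K * c = t * F →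
      (N * c : ℝ) ≤ M * F := by
    intro K t c F M hK hM h
    have hK' : (0 : ℝ) < K := by exact_mod_cast hK
    have h' : (K * c : ℝ) = t * F := by exact_mod_cast h
    have hM' : (t : ℝ) * N = K * M := by rw [hM]; field_simp
    refine le_of_mul_le_mul_left (le_of_eq ?_) hK'
    linear_combination (N : ℝ) * h' + F * hM'
  constructor
  · rintro (k | k)
    · change (Nat.card (Fin N × {p : SubPacket K₁ K₂ t₁ t₂ // Stores (Sum.inl k) p}) : ℝ) ≤
        M₁ * Nat.card (SubPacket K₁ K₂ t₁ t₂)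
      rw [Nat.card_prod, Nat.card_fin, Nat.cast_mul]
      exact size (by omega) hM₁ (card_stores_inl ht₁ k)
    · change (Nat.card (Fin N × {p : SubPacket K₁ K₂ t₁ t₂ // Stores (Sum.inr k) p}) : ℝ) ≤
        M₂ * Nat.card (SubPacket K₁ K₂ t₁ t₂)
      rw [Nat.card_prod, Nat.card_fin, Nat.cast_mul]
      exact size (by omega) hM₂ (card_stores_inr ht₂ k)
  · intro d u
    have : Nonempty (SubPacket K₁ K₂ t₁ t₂ → Fin b → ZMod 2) := ⟨fun _ _ => 0⟩
    refine exists_decoder (δ := SubPacket K₁ K₂ t₁ t₂ → Fin b → ZMod 2) _ _ _ fun W W' hp hs => ?_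
    have hp' : ∀ n p, Stores u p → W n p = W' n p := fun n p h => congrFun hp (n, ⟨p, h⟩)
    rcases u with k | k
    · exact recover_inl (V := Fin b → ZMod 2) k hp' hs
    · exact recover_inr (V := Fin b → ZMod 2) k hp' hs

theorem scheme_rate_le {N : ℕ} {M₁ M₂ : ℝ} (hN : 0 < N) (ht₁ : 1 ≤ t₁) (htK₁ : t₁ < K₁)
    (ht₂ : 1 ≤ t₂) (htK₂ : t₂ < K₂) (b : ℕ) (hb : 1 ≤ b)
    (m : (User K₁ K₂ → Fin N) → SaturatingMatching K₁ K₂ t₁ t₂ M₁ M₂) :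
    (scheme N ht₁ htK₁ ht₂ htK₂ b hb m).rate ≤
      if M₁ ≥ M₂ then ((K₂ : ℝ) - t₂) / t₂ else ((K₁ : ℝ) - t₁) / t₁ := by
  have : Nonempty (Fin N) := ⟨⟨0, hN⟩⟩
  have c₁ : (0 : ℝ) < K₁.choose t₁ := by exact_mod_cast Nat.choose_pos htK₁.le
  have c₂ : (0 : ℝ) < K₂.choose t₂ := by exact_mod_cast Nat.choose_pos htK₂.le
  have h₁ : (0 : ℝ) < t₁ := by exact_mod_cast ht₁
  have h₂ : (0 : ℝ) < t₂ := by exact_mod_cast ht₂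
  refine ciSup_le fun d => ?_
  change (Nat.card (Sent (m d)) : ℝ) / Nat.card (SubPacket K₁ K₂ t₁ t₂) ≤ _
  have hF : (Nat.card (SubPacket K₁ K₂ t₁ t₂) : ℝ) = K₁.choose t₁ * (K₂.choose t₂ * (t₂ * t₁)) := by
    exact_mod_cast card_subPacket K₁ K₂ t₁ t₂
  rw [hF, div_le_iff₀ (by positivity)]
  -- This identity turns the ratio of vertices to sub-packets into (K - t)/t.
  have choose : ∀ {K t : ℕ}, t < K →
      ((K.choose (t + 1) : ℝ) * (t + 1)) = K.choose t * (K - t) := fun {K t} h => by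
    have := Nat.choose_succ_right_eq K t
    rw [← Nat.cast_sub h.le]
    exact_mod_cast this
  split_ifs with hM
  · refine (Nat.cast_le.2 (card_sent_le_yVertex hM (m d))).trans (le_of_eq ?_)
    rw [card_yVertex]
    push_cast
    field_simp
    linear_combination (choose htK₂)
  · refine (Nat.cast_le.2 (card_sent_le_xVertex (not_le.1 hM) (m d))).trans (le_of_eq ?_)
    rw [card_xVertex]
    push_cast
    field_simp
    linear_combination (choose htK₁)

end CSM

/-! ### Assembly of the main theorem -/

theorem mainTheorem2 (K₁ K₂ N t₁ t₂ : ℕ) (M₁ M₂ : ℝ) (hKN : K₁ + K₂ < N)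
    (hM₁ : (t₁ : ℝ) = K₁ * M₁ / N) (hM₂ : (t₂ : ℝ) = K₂ * M₂ / N)
    (ht₁ : 1 ≤ t₁) (htK₁ : t₁ < K₁) (ht₂ : 1 ≤ t₂) (htK₂ : t₂ < K₂) :
    Nonempty (CSM.SaturatingMatching K₁ K₂ t₁ t₂ M₁ M₂) ∧
    ∀ (b : ℕ) (hb : 1 ≤ b)
      (m : (CSM.User K₁ K₂ → Fin N) → CSM.SaturatingMatching K₁ K₂ t₁ t₂ M₁ M₂),
      let S := CSM.scheme N ht₁ htK₁ ht₂ htK₂ b hb m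
      let M := CSM.cacheSize K₁ K₂ M₁ M₂
      S.IsValid M ∧
      0 < optimalRate M N ∧
      S.rate < 2 * heterogeneousRate M N ∧
      S.rate / optimalRate M N < 2 * heterogeneousRate M N / optimalRate M N ∧
      2 * heterogeneousRate M N / optimalRate M N < 12 ∧
      S.rate / optimalRate M N < 12 := by
  have hN : 0 < N := by omega
  have hN' : (0 : ℝ) < N := by exact_mod_cast hN
  have e₁ : (t₁ : ℝ) * N = K₁ * M₁ := by rw [hM₁]; field_simp
  have e₂ : (t₂ : ℝ) * N = K₂ * M₂ := by rw [hM₂]; field_simp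
  -- Comparing M₁ with M₂ is the same as comparing t₁K₂ with t₂K₁, the form required for the
  -- matching.
  have cross₁ : (t₂ * K₁ : ℝ) * N = K₁ * K₂ * M₂ := by linear_combination (K₁ : ℝ) * e₂
  have cross₂ : (t₁ * K₂ : ℝ) * N = K₁ * K₂ * M₁ := by linear_combination (K₂ : ℝ) * e₁
  refine ⟨CSM.nonempty_saturatingMatching htK₁ htK₂ (fun h => ?_) (fun h => ?_), ?_⟩
  · have : (t₂ * K₁ : ℝ) ≤ t₁ * K₂ := by
      refine le_of_mul_le_mul_right ?_ hN'
      rw [cross₁, cross₂]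
      gcongr
    exact_mod_cast this
  · have : (t₁ * K₂ : ℝ) ≤ t₂ * K₁ := by
      refine le_of_mul_le_mul_right ?_ hN'
      rw [cross₁, cross₂]
      gcongr
    exact_mod_cast this
  intro b hb m S M
  have hS : S.IsValid M := CSM.scheme_isValid hN hM₁ hM₂ ht₁ htK₁ ht₂ htK₂ b hb m
  have hrate : S.rate ≤ if M₁ ≥ M₂ then ((K₂ : ℝ) - t₂) / t₂ else ((K₁ : ℝ) - t₁) / t₁ :=
    CSM.scheme_rate_le hN ht₁ htK₁ ht₂ htK₂ b hb m
  have hmap : (Finset.univ.val.map M : Multiset ℝ) =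
      Multiset.replicate K₁ M₁ + Multiset.replicate K₂ M₂ := by
    rw [← Finset.univ_disjSum_univ, Finset.val_disjSum, Multiset.disjSum, Multiset.map_add]
    simp [M, CSM.cacheSize]
    rfl
  -- q is (K - t)/t for the group with the smaller caches. The scheme itself witnesses that the set
  -- defining R* is nonempty.
  obtain ⟨q, hq0, hSq, hRq, hqR, hqO⟩ : ∃ q : ℝ, 0 < q ∧ S.rate ≤ q ∧ heterogeneousRate M N < q ∧
      q < 2 * heterogeneousRate M N ∧ q ≤ 6 * optimalRate M N := by
    by_cases h : M₁ ≥ M₂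
    · rw [if_pos h] at hrate
      have hpos : (0 : ℝ) < (K₂ - t₂) / t₂ :=
        div_pos (sub_pos.2 (by exact_mod_cast htK₂)) (by exact_mod_cast ht₂)
      have hb := heterogeneousRate_bounds h (by rw [hmap, add_comm]) hN ht₂ htK₂ htK₁ hM₂ hM₁
      exact ⟨_, hpos, hrate, hb.1, hb.2, le_six_mul_optimalRate ⟨S, hS⟩ Sum.inr
        Sum.inr_injective (fun _ => rfl) ht₂ htK₂ (by omega) hM₂⟩
    · rw [if_neg h] at hrate
      have hpos : (0 : ℝ) < (K₁ - t₁) / t₁ :=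
        div_pos (sub_pos.2 (by exact_mod_cast htK₁)) (by exact_mod_cast ht₁)
      have hb := heterogeneousRate_bounds (not_le.1 h).le hmap hN ht₁ htK₁ htK₂ hM₁ hM₂
      exact ⟨_, hpos, hrate, hb.1, hb.2, le_six_mul_optimalRate ⟨S, hS⟩ Sum.inl
        Sum.inl_injective (fun _ => rfl) ht₁ htK₁ (by omega) hM₁⟩
  have hO : 0 < optimalRate M N := by linarith
  have h12 : 2 * heterogeneousRate M N / optimalRate M N < 12 := by
    rw [div_lt_iff₀ hO]; linarith
  have hlt : S.rate < 2 * heterogeneousRate M N := by linarith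
  have hdiv := div_lt_div_of_pos_right hlt hO
  exact ⟨hS, hO, hlt, hdiv, h12, hdiv.trans h12⟩
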